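/- **Theorem (Diagonalization of fermionic block operators).** Let $\mathfrak h$ be a complex separable Hilbert space, with inner product $\langle\cdot,\cdot\rangle$ anti-linear in the first variable, and let $\mathfrak h^*$ be its dual, a Hilbert space in the usual way. Let $J:\mathfrak h\to\mathfrak h^*$ be the anti-unitary operator $J(f)(g)=\langle f,g\rangle$, let $J^*=J^{-1}$, and let $\mathcal J$ be the anti-unitary operator on $\mathfrak h\oplus\mathfrak h^*$ given by $$\mathcal J=\begin{pmatrix}0&J^*\\ J&0\end{pmatrix},\qquad \mathcal J(f\oplus\varphi)=J^*\varphi\oplus Jf .$$ Let $B$ be a (possibly unbounded) self-adjoint operator on $\mathfrak h\oplus\mathfrak h^*$ such that $\mathcal J B\mathcal J=-B$ (including equality of domains) and such that $\dim\operatorname{Ker}(B)$ is either even (possibly $0$) or infinite. Then there exist a unitary operator $\mathcal U$ on $\mathfrak h\oplus\mathfrak h^*$ and a (possibly unbounded) self-adjoint operator $\xi\ge 0$ on $\mathfrak h$, i.e. $\langle x,\xi x\rangle\ge 0$ for all $x\in D(\xi)$, such that $\mathcal J\,\mathcal U\mathcal J=\mathcal U$ and $$\mathcal U B\,\mathcal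 U^*=\begin{pmatrix}\xi&0\\ 0&-J\xi J^*\end{pmatrix},$$ where the right-hand side has domain $D(\xi)\oplus JD(\xi)$. Moreover, if $\operatorname{Ker}(B)=\{0\}$, then $\xi>0$, i.e. $\langle x,\xi x\rangle>0$ for all $0\neq x\in D(\xi)$. -/

import Mathlib

noncomputable section

namespace Fermionic

/-- The dual of a complex Hilbert space `H` is a Hilbert space for the operator norm; its inner
product is `⟪J f, J g⟫ = ⟪g, f⟫`, where `J f = ⟪f, ·⟫` is the Riesz map. -/
instance dualInnerProductSpace (H : Type*) [NormedAddCommGroup H] [InnerProductSpace ℂ H]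
    [CompleteSpace H] : InnerProductSpace ℂ (StrongDual ℂ H) where
  inner φ ψ := inner ℂ ((InnerProductSpace.toDual ℂ H).symm ψ)
    ((InnerProductSpace.toDual ℂ H).symm φ)
  norm_sq_eq_re_inner φ := by
    rw [← (InnerProductSpace.toDual ℂ H).symm.norm_map φ]
    exact norm_sq_eq_re_inner _
  conj_inner_symm φ ψ := inner_conj_symm _ _
  add_left φ ψ χ := by simp
  smul_left φ ψ c := by
    rw [LinearIsometryEquiv.map_smulₛₗ, inner_smul_right]

section Spaces

variable (H : Type*) [NormedAddCommGroup H] [InnerProductSpace ℂ H] [CompleteSpace H]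

/-- The Hilbert space `H ⊕ H*`. -/
abbrev Doubled : Type _ := WithLp 2 (H × StrongDual ℂ H)

/-- The anti-unitary operator `J : H → H*`, `J f = ⟪f, ·⟫`. Its adjoint `J*` is `(J H).symm`. -/
abbrev J : H ≃ₗᵢ⋆[ℂ] StrongDual ℂ H := InnerProductSpace.toDual ℂ H

/-- The anti-unitary block operator `𝒥 = (0, J*; J, 0)` on `H ⊕ H*`,
that is `𝒥 (f ⊕ φ) = J* φ ⊕ J f`. -/
def calJ : Doubled H ≃ₗᵢ⋆[ℂ] Doubled H where
  toFun x := WithLp.toLp 2 ((J H).symm x.snd, J H x.fst)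
  invFun x := WithLp.toLp 2 ((J H).symm x.snd, J H x.fst)
  map_add' x y := by
    rw [WithLp.add_snd, WithLp.add_fst, map_add, map_add]
    rfl
  map_smul' c x := by
    rw [WithLp.smul_snd, WithLp.smul_fst,
      LinearIsometryEquiv.map_smulₛₗ, LinearIsometryEquiv.map_smulₛₗ]
    rfl
  left_inv x := by
    apply WithLp.ofLp_injective
    simp only [WithLp.toLp_fst, WithLp.toLp_snd, LinearIsometryEquiv.symm_apply_apply,
      LinearIsometryEquiv.apply_symm_apply]
    rfl
  right_inv x := by
    apply WithLp.ofLp_injective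
    simp only [WithLp.toLp_fst, WithLp.toLp_snd, LinearIsometryEquiv.symm_apply_apply,
      LinearIsometryEquiv.apply_symm_apply]
    rfl
  norm_map' x := by
    simp only [LinearEquiv.coe_mk, LinearMap.coe_mk, AddHom.coe_mk]
    rw [WithLp.prod_norm_eq_of_L2, WithLp.prod_norm_eq_of_L2, add_comm]
    simp only [WithLp.toLp_fst, WithLp.toLp_snd, LinearIsometryEquiv.norm_map]

theorem calJ_apply (x : Doubled H) :
    calJ H x = WithLp.toLp 2 ((J H).symm x.snd, J H x.fst) := rfl

theorem calJ_symm : (calJ H).symm = calJ H := rfl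

end Spaces

section Operators

/-- The operator `e T e⁻¹ = e T e*` for an unbounded operator `T` and a unitary
(`σ = RingHom.id ℂ`) or anti-unitary (`σ = starRingEnd ℂ`) operator `e`, with its natural
domain `{y | e⁻¹ y ∈ D(T)}`. -/
def conjugate {σ : ℂ →+* ℂ} [RingHomInvPair σ σ] {E F : Type*}
    [NormedAddCommGroup E] [InnerProductSpace ℂ E] [NormedAddCommGroup F] [InnerProductSpace ℂ F]
    (e : E ≃ₛₗᵢ[σ] F) (T : E →ₗ.[ℂ] E) : F →ₗ.[ℂ] F where
  domain :=
    { carrier := {y | e.symm y ∈ T.domain}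
      add_mem' := fun {a b} ha hb => by
        change e.symm (a + b) ∈ T.domain
        rw [map_add]; exact T.domain.add_mem ha hb
      zero_mem' := by
        change e.symm 0 ∈ T.domain
        rw [map_zero]; exact T.domain.zero_mem
      smul_mem' := fun c y hy => by
        change e.symm (c • y) ∈ T.domain
        rw [LinearIsometryEquiv.map_smulₛₗ]; exact T.domain.smul_mem _ hy }
  toFun :=
    { toFun := fun y => e (T ⟨e.symm y, y.2⟩)
      map_add' := fun a b => by
        rw [← map_add, ← LinearPMap.map_add]
        congr 2
        exact Subtype.ext (map_add e.symm (a : F) (b : F))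
      map_smul' := fun c y => by
        have h : (⟨e.symm ((c • y : _) : F), (c • y : _).2⟩ : T.domain)
            = σ c • (⟨e.symm (y : F), y.2⟩ : T.domain) :=
          Subtype.ext (LinearIsometryEquiv.map_smulₛₗ e.symm c (y : F))
        rw [h, LinearPMap.map_smul, LinearIsometryEquiv.map_smulₛₗ,
          RingHomInvPair.comp_apply_eq, RingHom.id_apply] }

/-- The block-diagonal operator `diag(S, T)` on `E ⊕ F`, with domain `D(S) ⊕ D(T)`. -/
def blockDiag {E F : Type*}
    [NormedAddCommGroup E] [InnerProductSpace ℂ E] [NormedAddCommGroup F] [InnerProductSpace ℂ F]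
    (S : E →ₗ.[ℂ] E) (T : F →ₗ.[ℂ] F) : WithLp 2 (E × F) →ₗ.[ℂ] WithLp 2 (E × F) where
  domain :=
    { carrier := {x | x.fst ∈ S.domain ∧ x.snd ∈ T.domain}
      add_mem' := fun ha hb => ⟨S.domain.add_mem ha.1 hb.1, T.domain.add_mem ha.2 hb.2⟩
      zero_mem' := ⟨S.domain.zero_mem, T.domain.zero_mem⟩
      smul_mem' := fun c _ hx => ⟨S.domain.smul_mem c hx.1, T.domain.smul_mem c hx.2⟩ }
  toFun :=
    { toFun := fun x => WithLp.toLp 2 (S ⟨x.1.fst, x.2.1⟩, T ⟨x.1.snd, x.2.2⟩)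
      map_add' := fun a b => by
        rw [← WithLp.toLp_add, Prod.mk_add_mk, ← LinearPMap.map_add, ← LinearPMap.map_add]
        rfl
      map_smul' := fun c x => by
        rw [RingHom.id_apply, ← WithLp.toLp_smul, Prod.smul_mk, ← LinearPMap.map_smul,
          ← LinearPMap.map_smul]
        rfl }

variable {E : Type*} [NormedAddCommGroup E] [InnerProductSpace ℂ E]

/-- The kernel `{x ∈ D(T) | T x = 0}` of an unbounded operator. -/
def ker (T : E →ₗ.[ℂ] E) : Submodule ℂ E :=
  (LinearMap.ker T.toFun).map T.domain.subtype

/-- `T ≥ 0`: `T` is self-adjoint and `⟪x, T x⟫ ≥ 0` for all `x ∈ D(T)`. -/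
def IsNonneg [CompleteSpace E] (T : E →ₗ.[ℂ] E) : Prop :=
  IsSelfAdjoint T ∧ ∀ x : T.domain, 0 ≤ (inner ℂ (x : E) (T x)).re

/-- `T > 0`: `T` is self-adjoint and `⟪x, T x⟫ > 0` for all `0 ≠ x ∈ D(T)`. -/
def IsPos [CompleteSpace E] (T : E →ₗ.[ℂ] E) : Prop :=
  IsSelfAdjoint T ∧ ∀ x : T.domain, (x : E) ≠ 0 → 0 < (inner ℂ (x : E) (T x)).re

end Operators

end Fermionic

end

namespace Fermionic

/-! ### Unbounded operators through their graphs -/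

section Graphs

variable {E F : Type*} [NormedAddCommGroup E] [InnerProductSpace ℂ E]
  [NormedAddCommGroup F] [InnerProductSpace ℂ F]

/-! The spectral decomposition of `B` is $E_+\oplus\operatorname{Ker}B\oplus E_-$. Since $\mathcal
J$ anticommutes with `B`, it exchanges $E_+$ and $E_-$ and preserves the kernel. If the kernel also
splits as $K\oplus\mathcal JK$, then $L=E_+\oplus K$ reduces `B`, `B` is nonnegative on $L$, and the
whole space is $L\oplus\mathcal JL$. Thus $L$ has the dimension of $\mathfrak h$; choose a unitary
$V:\mathfrak h\to L$. The map $W(f\oplus\varphi)=Vf+\mathcal JVJ^*\varphi$ is unitary and commutes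
with $\mathcal J$, and $\mathcal U=W^{-1}$, $\xi=V^*BV$ solve the problem.

Splitting the kernel is where parity enters: the vectors fixed by $\mathcal J$ form a real Hilbert
space, and pairing off its basis vectors gives $K$ as the span of the $e+ie'$ (`exists_isotropic`).

No unbounded spectral theorem is used. The bounded self-adjoint operator
$T=(B-i)^{-1}+(B+i)^{-1}=2B(B^2+1)^{-1}$ has the sign and the kernel of `B`, so $E_+$ is the closed
range of its positive part (`exists_reducing_nonneg_half`). -/

theorem mem_graph_conjugate {σ : ℂ →+* ℂ} [RingHomInvPair σ σ] (e : E ≃ₛₗᵢ[σ] F)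
    (T : E →ₗ.[ℂ] E) (x y : F) :
    (x, y) ∈ (conjugate e T).graph ↔ (e.symm x, e.symm y) ∈ T.graph := by
  simp only [LinearPMap.mem_graph_iff]
  constructor
  · rintro ⟨⟨u, hu⟩, rfl, rfl⟩
    exact ⟨⟨e.symm u, hu⟩, rfl, (e.symm_apply_apply _).symm⟩
  · rintro ⟨⟨u, hu⟩, h₁, h₂⟩
    dsimp only at h₁ h₂
    subst h₁
    exact ⟨⟨x, hu⟩, rfl, by
      change e (T ⟨e.symm x, hu⟩) = y
      rw [h₂, e.apply_symm_apply]⟩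

theorem mem_graph_blockDiag (S : E →ₗ.[ℂ] E) (T : F →ₗ.[ℂ] F) (x y : WithLp 2 (E × F)) :
    (x, y) ∈ (blockDiag S T).graph ↔
      (x.fst, y.fst) ∈ S.graph ∧ (x.snd, y.snd) ∈ T.graph := by
  simp only [LinearPMap.mem_graph_iff]
  constructor
  · rintro ⟨⟨u, hu⟩, rfl, rfl⟩
    exact ⟨⟨⟨u.fst, hu.1⟩, rfl, rfl⟩, ⟨⟨u.snd, hu.2⟩, rfl, rfl⟩⟩
  · rintro ⟨⟨⟨u, hu⟩, h₁, h₂⟩, ⟨⟨v, hv⟩, h₃, h₄⟩⟩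
    dsimp only at h₁ h₂ h₃ h₄
    subst h₁ h₃
    refine ⟨⟨x, hu, hv⟩, rfl, ?_⟩
    change WithLp.toLp 2 (S ⟨x.fst, hu⟩, T ⟨x.snd, hv⟩) = y
    rw [h₂, h₄]
    rfl

theorem mem_graph_neg (T : E →ₗ.[ℂ] F) (x : E) (y : F) :
    (x, y) ∈ (-T).graph ↔ (x, -y) ∈ T.graph := by
  simp only [LinearPMap.mem_graph_iff]
  constructor
  · rintro ⟨u, rfl, rfl⟩
    exact ⟨u, rfl, by simp⟩
  · rintro ⟨u, h, hy⟩
    exact ⟨u, h, by rw [LinearPMap.neg_apply, hy, neg_neg]⟩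

theorem mem_ker_iff (T : E →ₗ.[ℂ] E) (x : E) : x ∈ ker T ↔ (x, 0) ∈ T.graph := by
  simp only [ker, Submodule.mem_map, LinearMap.mem_ker, LinearPMap.mem_graph_iff]
  constructor
  · rintro ⟨u, h, rfl⟩
    exact ⟨u, rfl, h⟩
  · rintro ⟨u, h, h'⟩
    exact ⟨u, h', h⟩

theorem graph_ext {S T : E →ₗ.[ℂ] F} (h : ∀ x y, (x, y) ∈ S.graph ↔ (x, y) ∈ T.graph) :
    S = T :=
  LinearPMap.eq_of_eq_graph (by ext ⟨x, y⟩; exact h x y)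

variable [CompleteSpace E]

/-- Working with pairs in the graph keeps track of domain and value at once, so equalities of
domains need no separate argument. -/
theorem mem_graph_iff_of_isSelfAdjoint {T : E →ₗ.[ℂ] E} (hT : IsSelfAdjoint T) (x y : E) :
    (x, y) ∈ T.graph ↔ ∀ a b, (a, b) ∈ T.graph → inner ℂ b x = inner ℂ a y := by
  have h := LinearPMap.adjoint_graph_eq_graph_adjoint hT.dense_domain
  rw [LinearPMap.isSelfAdjoint_def.mp hT] at h
  nth_rewrite 1 [h]
  simp [Submodule.mem_adjoint_iff, sub_eq_zero]

theorem isSelfAdjoint_of_mem_graph_iff {T : E →ₗ.[ℂ] E} (hd : Dense (T.domain : Set E))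
    (h : ∀ x y, (x, y) ∈ T.graph ↔ ∀ a b, (a, b) ∈ T.graph → inner ℂ b x = inner ℂ a y) :
    IsSelfAdjoint T := by
  rw [LinearPMap.isSelfAdjoint_def]
  refine graph_ext fun x y => ?_
  rw [LinearPMap.adjoint_graph_eq_graph_adjoint hd, h]
  simp [Submodule.mem_adjoint_iff, sub_eq_zero]

end Graphs

/-! ### Resolvents at $\pm i$ -/

section Resolvent

variable {E : Type*} [NormedAddCommGroup E] [InnerProductSpace ℂ E] [CompleteSpace E]

theorem inner_im_eq_zero_of_mem_graph {T : E →ₗ.[ℂ] E} (hT : IsSelfAdjoint T) {x y : E}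
    (h : (x, y) ∈ T.graph) : (inner ℂ x y).im = 0 := by
  have h₁ := (mem_graph_iff_of_isSelfAdjoint hT x y).1 h x y h
  rw [← inner_conj_symm] at h₁
  exact Complex.conj_eq_iff_im.1 h₁

theorem norm_sub_smul_sq {T : E →ₗ.[ℂ] E} (hT : IsSelfAdjoint T) {ε : ℝ} (hε : ε ^ 2 = 1)
    {x y : E} (h : (x, y) ∈ T.graph) :
    ‖y - ((ε : ℂ) * Complex.I) • x‖ ^ 2 = ‖y‖ ^ 2 + ‖x‖ ^ 2 := by
  have h₀ := inner_im_eq_zero_of_mem_graph hT h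
  have h₁ : (inner ℂ y x).im = 0 := by rw [← inner_conj_symm, Complex.conj_im, h₀, neg_zero]
  have hn : ‖(ε : ℂ) * Complex.I‖ ^ 2 = 1 := by
    rw [norm_mul, Complex.norm_I, Complex.norm_real, mul_one, Real.norm_eq_abs, sq_abs, hε]
  rw [@norm_sub_sq ℂ, norm_smul, mul_pow, hn, inner_smul_right]
  simp [h₁]

/-- Von Neumann's argument: the graph is closed, so $(0,y)$ splits into a vector of the graph and
one orthogonal to it. Rotating the latter gives a vector of the graph of $T^*=T$, and a combination
of the two solves $(T-i\varepsilon)x=y$. -/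
theorem exists_mem_graph_sub_smul {T : E →ₗ.[ℂ] E} (hT : IsSelfAdjoint T) {ε : ℝ}
    (hε : ε ^ 2 = 1) (y : E) : ∃ x, (x, y + ((ε : ℂ) * Complex.I) • x) ∈ T.graph := by
  let G : Submodule ℂ (WithLp 2 (E × E)) :=
    T.graph.comap (WithLp.linearEquiv 2 ℂ (E × E)).toLinearMap
  have hG : IsClosed (G : Set (WithLp 2 (E × E))) :=
    IsClosed.preimage (WithLp.prod_continuous_ofLp 2 E E) hT.isClosed
  have : CompleteSpace G := hG.completeSpace_coe
  obtain ⟨u, hu, v, hv, huv⟩ := G.exists_add_mem_mem_orthogonal (WithLp.toLp 2 (0, y))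
  have hu' : (u.fst, u.snd) ∈ T.graph := hu
  have hv' : (v.snd, -v.fst) ∈ T.graph := by
    rw [mem_graph_iff_of_isSelfAdjoint hT]
    intro a b hab
    have := (Submodule.mem_orthogonal G v).1 hv (WithLp.toLp 2 (a, b)) hab
    rw [WithLp.prod_inner_apply] at this
    simp only [] at this
    rw [inner_neg_right, eq_neg_iff_add_eq_zero, add_comm]
    exact this
  have e₁ : 0 = u.fst + v.fst := congrArg WithLp.fst huv
  have e₂ : y = u.snd + v.snd := congrArg WithLp.snd huv
  refine ⟨u.fst + ((ε : ℂ) * Complex.I) • v.snd, ?_⟩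
  have hε' : (ε : ℂ) * Complex.I * ((ε : ℂ) * Complex.I) = -1 := by
    have : (ε : ℂ) ^ 2 = 1 := by exact_mod_cast hε
    linear_combination (Complex.I ^ 2) * this + Complex.I_sq
  have := T.graph.add_mem hu' (T.graph.smul_mem ((ε : ℂ) * Complex.I) hv')
  convert this using 1
  rw [Prod.smul_mk, Prod.mk_add_mk, smul_add, smul_smul, hε', e₂,
    eq_neg_of_add_eq_zero_left e₁.symm]
  congr 1
  module

/-- The resolvent `(T - i ε)⁻¹`, for `ε = ± 1`, of a self-adjoint operator. -/
theorem exists_resolvent {T : E →ₗ.[ℂ] E} (hT : IsSelfAdjoint T) {ε : ℝ} (hε : ε ^ 2 = 1) :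
    ∃ R : E →L[ℂ] E, ∀ x y, R y = x ↔ (x, y + ((ε : ℂ) * Complex.I) • x) ∈ T.graph := by
  choose f hf using exists_mem_graph_sub_smul hT hε
  have key : ∀ x y, (x, y + ((ε : ℂ) * Complex.I) • x) ∈ T.graph → ‖x‖ ≤ ‖y‖ := by
    intro x y h
    have := norm_sub_smul_sq hT hε h
    rw [add_sub_cancel_right] at this
    refine (sq_le_sq₀ (norm_nonneg _) (norm_nonneg _)).1 ?_
    rw [this]
    exact le_add_of_nonneg_left (sq_nonneg _)
  have uniq : ∀ x y, (x, y + ((ε : ℂ) * Complex.I) • x) ∈ T.graph → f y = x := by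
    intro x y h
    have h₁ := T.graph.sub_mem (hf y) h
    have h₂ := key (f y - x) 0 (by convert h₁ using 1; rw [Prod.mk_sub_mk]; congr 1; module)
    rw [norm_zero, norm_le_zero_iff, sub_eq_zero] at h₂
    exact h₂
  let L : E →ₗ[ℂ] E :=
    { toFun := f
      map_add' := fun a b => uniq _ _ (by
        have := T.graph.add_mem (hf a) (hf b)
        convert this using 1; rw [Prod.mk_add_mk]; congr 1; module)
      map_smul' := fun c a => uniq _ _ (by
        have := T.graph.smul_mem c (hf a)
        convert this using 1; rw [Prod.smul_mk]; congr 1; simp only [RingHom.id_apply]; module) }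
  refine ⟨L.mkContinuous 1 fun y => ?_, fun x y => ⟨?_, uniq x y⟩⟩
  · rw [one_mul]; exact key _ _ (hf y)
  · rintro rfl; exact hf y

end Resolvent

/-! ### Real structures and the splitting of the kernel -/

section RealStructure

variable {E : Type*} [NormedAddCommGroup E] [InnerProductSpace ℂ E] [CompleteSpace E]

/-- A closed subspace invariant under an anti-unitary involution `j` has an orthonormal basis of
vectors fixed by `j`. -/
theorem exists_orthonormal_fixed (j : E ≃ₗᵢ⋆[ℂ] E) (hj : ∀ x, j (j x) = x)
    (hin : ∀ x y, inner ℂ (j x) (j y) = inner ℂ y x) (N : Submodule ℂ E)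
    (hN : IsClosed (N : Set E)) (hjN : ∀ x ∈ N, j x ∈ N) :
    ∃ s : Set E, Orthonormal ℂ ((↑) : s → E) ∧ (∀ x ∈ s, j x = x ∧ x ∈ N) ∧
      ∀ x ∈ N, (∀ y ∈ s, inner ℂ y x = 0) → x = 0 := by
  classical
  let : InnerProductSpace ℝ E := InnerProductSpace.complexToReal
  let M : Submodule ℝ E :=
    { carrier := {x | j x = x ∧ x ∈ N}
      add_mem' := fun {a b} ha hb => ⟨by rw [map_add, ha.1, hb.1], N.add_mem ha.2 hb.2⟩
      zero_mem' := ⟨map_zero _, N.zero_mem⟩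
      smul_mem' := fun c x hx => ⟨by
        rw [← Complex.coe_smul, LinearIsometryEquiv.map_smulₛₗ, hx.1, Complex.conj_ofReal], by
        rw [← Complex.coe_smul]; exact N.smul_mem _ hx.2⟩ }
  have hM : IsClosed (M : Set E) := (isClosed_eq j.continuous continuous_id).inter hN
  have : CompleteSpace M := hM.completeSpace_coe
  -- Fixed vectors have real inner products, so a real orthonormal basis of `M` is orthonormal over
  -- ℂ.
  have hre : ∀ x y, j x = x → j y = y → inner ℂ x y = ((inner ℝ x y : ℝ) : ℂ) := by
    intro x y hx hy
    have h := hin x y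
    rw [hx, hy, ← inner_conj_symm y x] at h
    exact (Complex.conj_eq_iff_re.1 h.symm).symm
  obtain ⟨w, b, hb⟩ := exists_hilbertBasis ℝ M
  have hbo := b.orthonormal
  rw [hb] at hbo
  refine ⟨((↑) : M → E) '' w, ?_, ?_, ?_⟩
  · rw [orthonormal_subtype_iff_ite]
    rw [orthonormal_subtype_iff_ite] at hbo
    rintro _ ⟨x, hx, rfl⟩ _ ⟨y, hy, rfl⟩
    rw [hre _ _ x.2.1 y.2.1]
    have := hbo x hx y hy
    rw [Submodule.coe_inner] at this
    rw [this]
    split_ifs <;> simp_all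
  · rintro _ ⟨x, -, rfl⟩
    exact x.2
  · intro x hx h
    have hzero : ∀ z : M, (∀ y ∈ w, inner ℝ (y : E) (z : E) = 0) → (z : E) = 0 := by
      intro z hz
      have : b.repr z = 0 := by
        ext i
        rw [b.repr_apply_apply, hb, Submodule.coe_inner, hz _ i.2]
        rfl
      have : z = 0 := by simpa using this
      rw [this]; rfl
    -- Up to scalars, these are the real and imaginary parts of `x`; both are shown to vanish.
    have ha : x + j x ∈ M := ⟨by rw [map_add, hj, add_comm], N.add_mem hx (hjN x hx)⟩
    have hc : Complex.I • (x - j x) ∈ M := ⟨by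
      rw [LinearIsometryEquiv.map_smulₛₗ, map_sub, hj, Complex.conj_I]; module,
      N.smul_mem _ (N.sub_mem hx (hjN x hx))⟩
    have hjx : ∀ y ∈ w, inner ℂ (y : E) (j x) = 0 := by
      intro y hy
      rw [← y.2.1, hin, ← inner_conj_symm, h _ ⟨y, hy, rfl⟩, map_zero]
    have h₁ := hzero ⟨_, ha⟩ fun y hy => by
      have := hre y _ y.2.1 ha.1
      rw [inner_add_right, h _ ⟨y, hy, rfl⟩, hjx y hy, add_zero] at this
      exact_mod_cast this.symm
    have h₂ := hzero ⟨_, hc⟩ fun y hy => by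
      have := hre y _ y.2.1 hc.1
      rw [inner_smul_right, inner_sub_right, h _ ⟨y, hy, rfl⟩, hjx y hy, sub_zero,
        mul_zero] at this
      exact_mod_cast this.symm
    dsimp only at h₁ h₂
    rw [smul_eq_zero_iff_right Complex.I_ne_zero, sub_eq_zero] at h₂
    rw [← h₂, ← two_smul ℂ, smul_eq_zero_iff_right two_ne_zero] at h₁
    exact h₁

universe u in
/-- A type that is infinite or of even cardinality is the disjoint union of two copies of a
type. -/
theorem exists_equiv_sum_self (ι : Type u) (h : Finite ι → Even (Nat.card ι)) :
    ∃ κ : Type u, Nonempty (κ ⊕ κ ≃ ι) := by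
  rcases finite_or_infinite ι with hf | hi
  · obtain ⟨n, hn⟩ := h hf
    exact ⟨ULift (Fin n), Finite.card_eq.1 (by simp [hn])⟩
  · refine ⟨ι, Cardinal.eq.1 ?_⟩
    rw [Cardinal.mk_sum, Cardinal.lift_id, Cardinal.add_eq_self (Cardinal.aleph0_le_mk ι)]

/-- A closed subspace invariant under an anti-unitary involution `j`, of even or infinite
dimension, is the orthogonal sum of `K` and `j K`, with `K` spanned by a set `s`. -/
theorem exists_isotropic (j : E ≃ₗᵢ⋆[ℂ] E) (hj : ∀ x, j (j x) = x)
    (hin : ∀ x y, inner ℂ (j x) (j y) = inner ℂ y x) (N : Submodule ℂ E)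
    (hN : IsClosed (N : Set E)) (hjN : ∀ x ∈ N, j x ∈ N)
    (hdim : ¬ FiniteDimensional ℂ N ∨ Even (Module.finrank ℂ N)) :
    ∃ s : Set E, (∀ x ∈ s, x ∈ N) ∧ (∀ x ∈ s, ∀ y ∈ s, inner ℂ x (j y) = 0) ∧
      ∀ x ∈ N, (∀ y ∈ s, inner ℂ y x = 0) → (∀ y ∈ s, inner ℂ (j y) x = 0) → x = 0 := by
  classical
  obtain ⟨t, ht, htN, htot⟩ := exists_orthonormal_fixed j hj hin N hN hjN
  have hcard : Finite t → Even (Nat.card t) := by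
    intro hfin
    have hspan : N = Submodule.span ℂ t := by
      refine le_antisymm (fun x hx => ?_) (Submodule.span_le.2 fun x hx => (htN x hx).2)
      have : FiniteDimensional ℂ (Submodule.span ℂ t) :=
        FiniteDimensional.span_of_finite ℂ (Set.toFinite t)
      obtain ⟨u, hu, v, hv, rfl⟩ := (Submodule.span ℂ t).exists_add_mem_mem_orthogonal x
      have huN : u ∈ N := Submodule.span_le.2 (fun x hx => (htN x hx).2) hu
      have : v = 0 := htot v ((N.add_mem_iff_right huN).1 hx) fun y hy =>
        (Submodule.mem_orthogonal _ _).1 hv y (Submodule.subset_span hy)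
      rwa [this, add_zero]
    have : Fintype t := Fintype.ofFinite t
    have hfr : Module.finrank ℂ N = Nat.card t := by
      rw [hspan, Nat.card_eq_fintype_card, ← Set.toFinset_card]
      exact finrank_span_set_eq_card ht.linearIndependent
    rw [← hfr]
    refine hdim.resolve_left fun h => h ?_
    rw [hspan]
    exact FiniteDimensional.span_of_finite ℂ (Set.toFinite t)
  obtain ⟨κ, ⟨φ⟩⟩ := exists_equiv_sum_self t hcard
  have hin' : ∀ a b : κ ⊕ κ, inner ℂ (φ a : E) (φ b : E) = if φ a = φ b then 1 else 0 := by
    intro a b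
    have := orthonormal_iff_ite.1 ht (φ a) (φ b)
    simpa using this
  have hjφ : ∀ a, j (φ a) = φ a := fun a => (htN _ (φ a).2).1
  -- For orthonormal fixed $e,e'$, $\langle e+ie',e-ie'\rangle=1-1=0$, and these two vectors span
  -- the same plane as $e,e'$. Normalization is irrelevant, as only spans matter.
  let f : κ → E := fun k => φ (.inl k) + Complex.I • (φ (.inr k) : E)
  have hjf : ∀ k, j (f k) = φ (.inl k) - Complex.I • (φ (.inr k) : E) := by
    intro k
    simp only [f]
    rw [map_add, LinearIsometryEquiv.map_smulₛₗ, hjφ, hjφ, Complex.conj_I]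
    module
  refine ⟨Set.range f, ?_, ?_, ?_⟩
  · rintro _ ⟨k, rfl⟩
    exact N.add_mem (htN _ (φ _).2).2 (N.smul_mem _ (htN _ (φ _).2).2)
  · rintro _ ⟨k, rfl⟩ _ ⟨l, rfl⟩
    rw [hjf]
    simp only [f, inner_add_left, inner_sub_right, inner_smul_left, inner_smul_right, hin',
      EmbeddingLike.apply_eq_iff_eq, Sum.inl.injEq, Sum.inr.injEq, reduceCtorEq, if_false,
      Complex.conj_I]
    split_ifs <;> simp
  · intro x hx h₁ h₂
    refine htot x hx fun y hy => ?_
    have key : ∀ k, inner ℂ (φ (.inl k) : E) x = 0 ∧ inner ℂ (φ (.inr k) : E) x = 0 := by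
      intro k
      have e₁ := h₁ _ ⟨k, rfl⟩
      have e₂ := h₂ _ ⟨k, rfl⟩
      rw [hjf] at e₂
      simp only [f] at e₁
      rw [inner_add_left, inner_smul_left, Complex.conj_I] at e₁
      rw [inner_sub_left, inner_smul_left, Complex.conj_I] at e₂
      constructor
      · linear_combination (e₁ + e₂) / 2
      · linear_combination (e₁ - e₂) * Complex.I / 2 + inner ℂ (φ (.inr k) : E) x * Complex.I_sq
    obtain ⟨a, ha⟩ := φ.surjective ⟨y, hy⟩
    rw [show y = (φ a : E) by rw [ha]]
    rcases a with k | k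
    · exact (key k).1
    · exact (key k).2

end RealStructure

/-! ### The nonnegative half of the space -/

section PositiveHalf

variable {E : Type*} [NormedAddCommGroup E] [InnerProductSpace ℂ E] [CompleteSpace E]

open ContinuousLinearMap in
/-- If an anti-unitary involution `j` anticommutes with a self-adjoint operator `T`, then it
intertwines the positive and negative parts of `T`. -/
theorem negPart_apply_eq_of_anticommute (j : E ≃ₗᵢ⋆[ℂ] E) (hj : ∀ x, j (j x) = x)
    (hin : ∀ x y, inner ℂ (j x) (j y) = inner ℂ y x) {T : E →L[ℂ] E} (hT : IsSelfAdjoint T)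
    (hjT : ∀ x, T (j x) = -j (T x)) (x : E) : T⁻ x = j (T⁺ (j x)) := by
  let k : (E →L[ℂ] E) → (E →L[ℂ] E) := fun A =>
    (j.toContinuousLinearEquiv.toContinuousLinearMap).comp
      (A.comp j.toContinuousLinearEquiv.toContinuousLinearMap)
  have hk : ∀ A x, k A x = j (A (j x)) := fun A x => rfl
  have hpos : ∀ A : E →L[ℂ] E, 0 ≤ A → 0 ≤ k A := by
    intro A hA
    rw [nonneg_iff_isPositive] at hA ⊢
    refine ⟨fun x y => ?_, fun x => ?_⟩
    · have h := hA.isSymmetric (j y) (j x)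
      simp only [coe_coe] at h ⊢
      rw [hk, hk, ← hj y, hin, hj, ← hj x, hin, hj, h]
    · rw [reApplyInnerSelf_apply, hk]
      nth_rewrite 2 [← hj x]
      rw [hin]
      exact hA.re_inner_nonneg_right (j x)
  -- $T=-jTj=jT^-j-jT^+j$ is a difference of positive operators with product zero, hence the
  -- canonical decomposition.
  have h := CFC.posPart_negPart_unique (a := T) (b := k T⁻) (c := k T⁺) ?_ ?_
    (hpos _ (CFC.negPart_nonneg T)) (hpos _ (CFC.posPart_nonneg T))
  · nth_rewrite 1 [h.2]
    exact hk _ _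
  · ext x
    rw [sub_apply, hk, hk, ← map_sub, ← neg_sub, map_neg, ← sub_apply,
      CFC.posPart_sub_negPart T hT, ← hjT, hj]
  · ext x
    have h₁ : T⁻ (T⁺ (j x)) = 0 := DFunLike.congr_fun (CFC.negPart_mul_posPart T) (j x)
    change k T⁻ (k T⁺ x) = 0
    rw [hk, hk, hj, h₁, map_zero]

/-- If an anti-unitary involution `j` anticommutes with a self-adjoint operator `B` whose kernel
has even or infinite dimension, then the space is the orthogonal sum of `L` and `j L`, where `L`
reduces `B` and `B` is nonnegative on `L`. -/
theorem exists_reducing_nonneg_half (j : E ≃ₗᵢ⋆[ℂ] E) (hj : ∀ x, j (j x) = x)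
    (hin : ∀ x y, inner ℂ (j x) (j y) = inner ℂ y x) {B : E →ₗ.[ℂ] E} (hB : IsSelfAdjoint B)
    (hjB : ∀ x y, (x, y) ∈ B.graph → (j x, -j y) ∈ B.graph)
    (hker : ¬ FiniteDimensional ℂ (ker B) ∨ Even (Module.finrank ℂ (ker B))) :
    ∃ L : Submodule ℂ E, IsClosed (L : Set E) ∧
      (∀ x ∈ L, ∀ y ∈ L, inner ℂ x (j y) = 0) ∧
      (∀ x, (∀ y ∈ L, inner ℂ y x = 0) → (∀ y ∈ L, inner ℂ (j y) x = 0) → x = 0) ∧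
      (∀ x y, (x, y) ∈ B.graph → ∃ u ∈ L, ∃ v ∈ L, (u, v) ∈ B.graph ∧
        x - u ∈ Lᗮ ∧ y - v ∈ Lᗮ) ∧
      ∀ x y, (x, y) ∈ B.graph → x ∈ L → 0 ≤ (inner ℂ x y).re := by
  obtain ⟨R, hR⟩ := exists_resolvent hB (ε := 1) (by norm_num)
  obtain ⟨S, hS⟩ := exists_resolvent hB (ε := -1) (by norm_num)
  simp only [Complex.ofReal_one, one_mul, Complex.ofReal_neg, neg_mul, neg_smul,
    ← sub_eq_add_neg] at hR hS
  have hRg : ∀ y, (R y, y + Complex.I • R y) ∈ B.graph := fun y => (hR _ _).1 rfl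
  have hSg : ∀ y, (S y, y - Complex.I • S y) ∈ B.graph := fun y => (hS _ _).1 rfl
  have hadj : ∀ x y, inner ℂ (R x) y = inner ℂ x (S y) := by
    intro x y
    have h := (mem_graph_iff_of_isSelfAdjoint hB _ _).1 (hSg y) _ _ (hRg x)
    rw [inner_add_left, inner_sub_right, inner_smul_left, inner_smul_right, Complex.conj_I] at h
    linear_combination -h
  have hSR : S = ContinuousLinearMap.adjoint R := by
    rw [ContinuousLinearMap.eq_adjoint_iff]
    intro x y
    rw [← inner_conj_symm, ← hadj, inner_conj_symm]
  -- Both forms of the resolvent identity, $R-S=2iRS$ and $R-S=2iSR$.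
  have hcomm : Commute R S := by
    ext y
    have h₁ : R (y - (2 * Complex.I) • S y) = S y :=
      (hR _ _).2 (by convert hSg y using 2; module)
    have h₂ : S (y + (2 * Complex.I) • R y) = R y :=
      (hS _ _).2 (by convert hRg y using 2; module)
    rw [map_sub, map_smul, sub_eq_iff_eq_add] at h₁
    rw [map_add, map_smul] at h₂
    have h₂ := add_left_cancel (h₂.trans h₁)
    exact (smul_right_injective E (by simp : (2 * Complex.I) ≠ 0) h₂).symm
  let T : E →L[ℂ] E := R + S
  have hT : IsSelfAdjoint T := by
    rw [ContinuousLinearMap.isSelfAdjoint_iff', map_add, hSR,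
      ContinuousLinearMap.adjoint_adjoint, add_comm]
    simp only [T, hSR]
  have hTR : Commute T R := (Commute.refl R).add_left hcomm.symm
  have hTS : Commute T S := hcomm.add_left (Commute.refl S)
  let A : E →L[ℂ] E := T⁺
  let C : E →L[ℂ] E := T⁻
  have hAR : ∀ x, A (R x) = R (A x) := fun x =>
    DFunLike.congr_fun (hTR.cfcₙ_real (·⁺)).eq x
  have hAS : ∀ x, A (S x) = S (A x) := fun x =>
    DFunLike.congr_fun (hTS.cfcₙ_real (·⁺)).eq x
  have hAC : ∀ x, A (C x) = 0 := fun x => DFunLike.congr_fun (CFC.posPart_mul_negPart T) x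
  have hCA : ∀ x, C (A x) = 0 := fun x => DFunLike.congr_fun (CFC.negPart_mul_posPart T) x
  have hAsubC : ∀ x, A x - C x = T x := fun x =>
    DFunLike.congr_fun (CFC.posPart_sub_negPart T hT) x
  have hApos : A.IsPositive :=
    (ContinuousLinearMap.nonneg_iff_isPositive _).1 (CFC.posPart_nonneg T)
  have hCpos : C.IsPositive :=
    (ContinuousLinearMap.nonneg_iff_isPositive _).1 (CFC.negPart_nonneg T)
  have hAsymm : ∀ x y, inner ℂ (A x) y = inner ℂ x (A y) := hApos.isSymmetric
  have hCsymm : ∀ x y, inner ℂ (C x) y = inner ℂ x (C y) := hCpos.isSymmetric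
  have hjR : ∀ x, R (j x) = -j (R x) := by
    intro x
    rw [hR]
    have := B.graph.neg_mem (hjB _ _ (hRg x))
    convert this using 1
    rw [Prod.neg_mk, map_add, LinearIsometryEquiv.map_smulₛₗ, Complex.conj_I]
    congr 1
    module
  have hjS : ∀ x, S (j x) = -j (S x) := by
    intro x
    rw [hS]
    have := B.graph.neg_mem (hjB _ _ (hSg x))
    convert this using 1
    rw [Prod.neg_mk, map_sub, LinearIsometryEquiv.map_smulₛₗ, Complex.conj_I]
    congr 1
    module
  have hjT : ∀ x, T (j x) = -j (T x) := by
    intro x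
    simp only [T, add_apply, map_add, hjR, hjS]
    abel
  have hjA : ∀ x, j (A x) = C (j x) := by
    intro x
    have := negPart_apply_eq_of_anticommute j hj hin hT hjT (j x)
    rw [hj] at this
    exact this.symm
  have hRker : ∀ x ∈ ker B, R x = Complex.I • x := by
    intro x hx
    rw [mem_ker_iff] at hx
    rw [hR, smul_smul, Complex.I_mul_I, neg_one_smul, add_neg_cancel]
    simpa using B.graph.smul_mem Complex.I hx
  have hSker : ∀ x ∈ ker B, S x = -Complex.I • x := by
    intro x hx
    rw [mem_ker_iff] at hx
    rw [hS, smul_smul, mul_neg, Complex.I_mul_I, neg_neg, one_smul, sub_self]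
    simpa using B.graph.smul_mem (-Complex.I) hx
  have hkerT : ∀ x, x ∈ ker B ↔ T x = 0 := by
    intro x
    constructor
    · intro hx
      simp only [T, add_apply, hRker x hx, hSker x hx]
      module
    -- If $Sx=-Rx$, adding the two resolvent pairs gives $x=-iRx$, and subtracting them gives
    -- $(2Rx,0)$ in the graph.
    · intro hx
      have h₁ : S x = -R x := eq_neg_of_add_eq_zero_right hx
      have h₂ := hSg x
      rw [h₁] at h₂
      have h₃ := B.graph.sub_mem (hRg x) h₂
      have h₄ := B.graph.add_mem (hRg x) h₂
      rw [Prod.mk_sub_mk] at h₃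
      rw [Prod.mk_add_mk, add_neg_cancel] at h₄
      have h₅ := B.graph_fst_eq_zero_snd h₄ rfl
      have h₆ : x = -Complex.I • R x := by
        have : (2 : ℂ) • (x + Complex.I • R x) = 0 := by rw [← h₅]; module
        rw [smul_eq_zero_iff_right two_ne_zero] at this
        rw [neg_smul]
        exact eq_neg_of_add_eq_zero_left this
      rw [mem_ker_iff]
      have h₇ := B.graph.smul_mem (-Complex.I / 2) h₃
      convert h₇ using 1
      rw [Prod.smul_mk]
      congr 1
      · nth_rewrite 1 [h₆]; module
      · module
  have hkerA : ∀ x ∈ ker B, A x = 0 := by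
    intro x hx
    have h := hAsubC x
    rw [(hkerT x).1 hx, sub_eq_zero] at h
    rw [← inner_self_eq_zero (𝕜 := ℂ), hAsymm]
    rw [h, hAC, inner_zero_right]
  have hkerC : ∀ x ∈ ker B, C x = 0 := by
    intro x hx
    have h := hAsubC x
    rw [(hkerT x).1 hx, hkerA x hx, zero_sub, neg_eq_zero] at h
    exact h
  have hkerj : ∀ x ∈ ker B, j x ∈ ker B := by
    intro x hx
    rw [hkerT] at hx ⊢
    rw [hjT, hx, map_zero, neg_zero]
  have hkerclosed : IsClosed (ker B : Set E) := by
    have : (ker B : Set E) = T ⁻¹' {0} := Set.ext hkerT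
    rw [this]
    exact isClosed_singleton.preimage T.continuous
  obtain ⟨s, hsN, hsj, hstot⟩ := exists_isotropic j hj hin (ker B) hkerclosed hkerj hker
  -- The positive spectral subspace together with half of the kernel.
  let L : Submodule ℂ E := (Submodule.span ℂ (Set.range A ∪ s)).topologicalClosure
  have hmin : ∀ M : Submodule ℂ E, IsClosed (M : Set E) → (∀ x, A x ∈ M) → (∀ x ∈ s, x ∈ M) →
      L ≤ M := by
    intro M hM h₁ h₂
    refine Submodule.topologicalClosure_minimal _ (Submodule.span_le.2 ?_) hM
    rintro _ (⟨x, rfl⟩ | hx)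
    · exact h₁ x
    · exact h₂ _ hx
  have hAL : ∀ x, A x ∈ L := fun x =>
    Submodule.le_topologicalClosure _ (Submodule.subset_span (Or.inl ⟨x, rfl⟩))
  have hsL : ∀ x ∈ s, x ∈ L := fun x hx =>
    Submodule.le_topologicalClosure _ (Submodule.subset_span (Or.inr hx))
  have hLclosed : IsClosed (L : Set E) := Submodule.isClosed_topologicalClosure _
  have : CompleteSpace L := hLclosed.completeSpace_coe
  -- The bilinear form $\langle x,jy\rangle$ is symmetric, so $L\perp jL$ can be checked on
  -- generators in each variable in turn.
  have hswap : ∀ x y, inner ℂ x (j y) = inner ℂ y (j x) := by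
    intro x y
    rw [← hin, hj]
  have hperp : ∀ z, (∀ x, inner ℂ (A x) z = 0) → (∀ x ∈ s, inner ℂ x z = 0) →
      ∀ x ∈ L, inner ℂ x z = 0 := by
    intro z h₁ h₂ x hx
    refine (Submodule.mem_orthogonal_singleton_iff_inner_left).1
      (hmin (ℂ ∙ z)ᗮ (Submodule.isClosed_orthogonal _) (fun x => ?_) (fun x hx => ?_) hx)
    · exact (Submodule.mem_orthogonal_singleton_iff_inner_left).2 (h₁ x)
    · exact (Submodule.mem_orthogonal_singleton_iff_inner_left).2 (h₂ x hx)
  have hLA : ∀ b, ∀ x ∈ L, inner ℂ x (j (A b)) = 0 := by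
    intro b
    rw [hjA]
    refine hperp _ (fun a => ?_) (fun x hx => ?_)
    · rw [hAsymm, hAC, inner_zero_right]
    · rw [← hCsymm, hkerC x (hsN x hx), inner_zero_left]
  have hLs : ∀ y ∈ s, ∀ x ∈ L, inner ℂ x (j y) = 0 := by
    intro y hy
    refine hperp _ (fun a => ?_) (fun x hx => hsj x hx y hy)
    rw [hAsymm, hkerA _ (hkerj y (hsN y hy)), inner_zero_right]
  have hLR : ∀ x ∈ L, R x ∈ L := by
    refine hmin (L.comap R.toLinearMap) (hLclosed.preimage R.continuous) (fun x => ?_)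
      (fun x hx => ?_)
    · change R (A x) ∈ L
      rw [← hAR]; exact hAL _
    · change R x ∈ L
      rw [hRker x (hsN x hx)]; exact L.smul_mem _ (hsL x hx)
  have hLS : ∀ x ∈ L, S x ∈ L := by
    refine hmin (L.comap S.toLinearMap) (hLclosed.preimage S.continuous) (fun x => ?_)
      (fun x hx => ?_)
    · change S (A x) ∈ L
      rw [← hAS]; exact hAL _
    · change S x ∈ L
      rw [hSker x (hsN x hx)]; exact L.smul_mem _ (hsL x hx)
  have hLR' : ∀ x ∈ Lᗮ, R x ∈ Lᗮ := by
    intro x hx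
    rw [Submodule.mem_orthogonal'] at hx ⊢
    intro u hu
    rw [hadj]
    exact hx _ (hLS u hu)
  have hLC : ∀ x ∈ L, C x = 0 :=
    hmin (LinearMap.ker C.toLinearMap) (C.isClosed_ker) hCA fun x hx => hkerC x (hsN x hx)
  -- `R` preserves both `L` and `Lᗮ`, so splitting $(B-i)x$ along them splits the pair $(x,y)$
  -- inside the graph.
  have hdecomp : ∀ x y, (x, y) ∈ B.graph → ∃ u ∈ L, ∃ v ∈ Lᗮ, y = u + v + Complex.I • x ∧
      x = R u + R v := by
    intro x y hxy
    have h : R (y - Complex.I • x) = x := (hR _ _).2 (by rwa [sub_add_cancel])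
    obtain ⟨u, hu, v, hv, huv⟩ := L.exists_add_mem_mem_orthogonal (y - Complex.I • x)
    exact ⟨u, hu, v, hv, by rw [← huv, sub_add_cancel], by rw [← map_add, ← huv, h]⟩
  refine ⟨L, hLclosed, fun x hx => ?_, fun x h₁ h₂ => ?_, fun x y hxy => ?_, fun x y hxy hx => ?_⟩
  · intro y hy
    rw [hswap]
    refine hperp _ (fun b => ?_) (fun z hz => ?_) y hy
    · rw [hswap]; exact hLA b x hx
    · rw [hswap]; exact hLs z hz x hx
  · have hA : A x = 0 := ext_inner_left ℂ fun y => by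
      rw [← hAsymm, h₁ _ (hAL y), inner_zero_right]
    have hC : C x = 0 := ext_inner_left ℂ fun y => by
      rw [← hCsymm, ← hj y, ← hjA, h₂ _ (hAL _), inner_zero_right]
    refine hstot x ((hkerT x).2 ?_) (fun y hy => h₁ y (hsL y hy)) (fun y hy => h₂ y (hsL y hy))
    rw [← hAsubC, hA, hC, sub_zero]
  · obtain ⟨u, hu, v, hv, rfl, rfl⟩ := hdecomp x y hxy
    refine ⟨R u, hLR u hu, u + Complex.I • R u, L.add_mem hu (L.smul_mem _ (hLR u hu)), hRg u,
      ?_, ?_⟩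
    · rw [add_sub_cancel_left]; exact hLR' v hv
    · have : u + v + Complex.I • (R u + R v) - (u + Complex.I • R u) = v + Complex.I • R v := by
        module
      rw [this]
      exact Lᗮ.add_mem hv (Lᗮ.smul_mem _ (hLR' v hv))
  · obtain ⟨u, hu, v, hv, rfl, rfl⟩ := hdecomp x y hxy
    have hRv : R v = 0 := by
      have h₁ : R v ∈ L := (L.add_mem_iff_right (hLR u hu)).1 hx
      exact inner_self_eq_zero.1 ((Submodule.mem_orthogonal _ _).1 (hLR' v hv) _ h₁)
    have hv0 : v = 0 := by
      have := hRg v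
      rw [hRv, smul_zero, add_zero] at this
      exact B.graph_fst_eq_zero_snd this rfl
    -- Here $x=Ru$ with $u\in L$, where $T^-$ vanishes, so $\operatorname{Re}\langle
    -- x,Bx\rangle=\operatorname{Re}\langle Ru,u\rangle=\tfrac12\langle u,T^+u\rangle\ge0$.
    have h₁ := hApos.re_inner_nonneg_right u
    have h₂ := hAsubC u
    rw [hLC u hu, sub_zero] at h₂
    rw [h₂] at h₁
    have h₃ : (inner ℂ (R u) (R u)).im = 0 := inner_self_im (𝕜 := ℂ) _
    have h₄ : (inner ℂ u (R u)).re = (inner ℂ (R u) u).re := by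
      rw [← inner_conj_symm, Complex.conj_re]
    simp only [T, add_apply, inner_add_right, ← hadj, RCLike.re_to_complex, Complex.add_re,
      h₄] at h₁
    subst hv0
    simp only [map_zero, add_zero, inner_add_right, inner_smul_right, Complex.add_re,
      Complex.I_mul_re, h₃]
    linarith

end PositiveHalf

/-! ### Classification of separable Hilbert spaces by dimension -/

section SeparableHilbert

/-- Orthonormal vectors are at distance $\sqrt2$, so the balls of radius $1/2$ around them are
disjoint. -/
theorem countable_of_orthonormal {E : Type*} [NormedAddCommGroup E] [InnerProductSpace ℂ E]
    [TopologicalSpace.SeparableSpace E] {ι : Type*} {v : ι → E} (hv : Orthonormal ℂ v) :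
    Countable ι := by
  rw [← Set.countable_univ_iff]
  refine Set.PairwiseDisjoint.countable_of_isOpen (s := fun i => Metric.ball (v i) (1 / 2))
    (fun i _ k _ hik => ?_) (fun i _ => Metric.isOpen_ball)
    (fun i _ => Metric.nonempty_ball.2 (by norm_num))
  refine Metric.ball_disjoint_ball ?_
  have h : ‖v i - v k‖ ^ 2 = 2 := by
    rw [@norm_sub_sq ℂ, hv.2 hik, hv.1, hv.1]
    norm_num
  rw [dist_eq_norm]
  nlinarith [norm_nonneg (v i - v k)]

theorem exists_hilbertBasis_nat (E : Type*) [NormedAddCommGroup E] [InnerProductSpace ℂ E]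
    [CompleteSpace E] [TopologicalSpace.SeparableSpace E] (h : ¬ FiniteDimensional ℂ E) :
    Nonempty (HilbertBasis ℕ ℂ E) := by
  obtain ⟨w, b, -⟩ := exists_hilbertBasis ℂ E
  have : Countable w := countable_of_orthonormal b.orthonormal
  have : Infinite w := by
    by_contra hw
    rw [not_infinite_iff_finite] at hw
    have : Fintype w := Fintype.ofFinite w
    exact h b.toOrthonormalBasis.toBasis.finiteDimensional_of_finite
  obtain ⟨e⟩ := nonempty_equiv_of_countable (α := ℕ) (β := w)
  refine ⟨HilbertBasis.mk (b.orthonormal.comp e e.injective) ?_⟩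
  rw [e.surjective.range_comp, b.dense_span]

/-- The finiteness equivalence is separate from the rank condition because `finrank` is 0 in
infinite dimension. -/
theorem nonempty_linearIsometryEquiv (E F : Type*) [NormedAddCommGroup E]
    [InnerProductSpace ℂ E] [CompleteSpace E] [TopologicalSpace.SeparableSpace E]
    [NormedAddCommGroup F] [InnerProductSpace ℂ F] [CompleteSpace F]
    [TopologicalSpace.SeparableSpace F]
    (h : FiniteDimensional ℂ E ↔ FiniteDimensional ℂ F)
    (hr : FiniteDimensional ℂ E → Module.finrank ℂ E = Module.finrank ℂ F) :
    Nonempty (E ≃ₗᵢ[ℂ] F) := by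
  by_cases hE : FiniteDimensional ℂ E
  · have hF := h.1 hE
    exact ⟨(stdOrthonormalBasis ℂ E).equiv (stdOrthonormalBasis ℂ F) (finCongr (hr hE))⟩
  · obtain ⟨b⟩ := exists_hilbertBasis_nat E hE
    obtain ⟨c⟩ := exists_hilbertBasis_nat F (fun hF => hE (h.2 hF))
    exact ⟨b.repr.trans c.repr.symm⟩

/-- Conjugation is a field automorphism, so twisting scalars by it preserves rank. -/
theorem finrank_eq_of_antilinearEquiv {E F : Type*} [AddCommGroup E] [Module ℂ E]
    [AddCommGroup F] [Module ℂ F] (e : E ≃ₛₗ[starRingEnd ℂ] F) :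
    Module.finrank ℂ E = Module.finrank ℂ F := by
  have h := lift_rank_eq_of_equiv_equiv (starRingEnd ℂ) e.toAddEquiv
    (Function.Involutive.bijective Complex.conj_conj) fun r m => e.map_smulₛₗ r m
  rw [Module.finrank, Module.finrank, ← Cardinal.toNat_lift, h, Cardinal.toNat_lift]

end SeparableHilbert

/-! ### Restriction to a reducing subspace and strict positivity -/

section Compression

variable {E F : Type*} [NormedAddCommGroup E] [InnerProductSpace ℂ E]
  [NormedAddCommGroup F] [InnerProductSpace ℂ F]

/-- The restriction of `B` to the range of `V`, seen as an operator on the source of `V`. -/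
noncomputable def restrictAlong (V : F →ₗᵢ[ℂ] E) (B : E →ₗ.[ℂ] E) : F →ₗ.[ℂ] F :=
  (B.graph.comap (V.toLinearMap.prodMap V.toLinearMap)).toLinearPMap

theorem mem_graph_restrictAlong (V : F →ₗᵢ[ℂ] E) (B : E →ₗ.[ℂ] E) (x y : F) :
    (x, y) ∈ (restrictAlong V B).graph ↔ (V x, V y) ∈ B.graph := by
  rw [restrictAlong, Submodule.toLinearPMap_graph_eq]
  · rfl
  · rintro ⟨a, b⟩ hab ha
    have hab' : (V a, V b) ∈ B.graph := hab
    have h := B.graph_fst_eq_zero_snd hab' (by rw [show a = 0 from ha, map_zero])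
    exact (map_eq_zero_iff V V.injective).1 h

/-- `hred` says that projecting onto the range of `V` maps the graph of `B` into itself. Hence the
restricted domain is dense, and testing a pair in the range against the graph of `B` amounts to
testing it against the restricted graph. -/
theorem isSelfAdjoint_restrictAlong [CompleteSpace E] [CompleteSpace F] (V : F →ₗᵢ[ℂ] E)
    {B : E →ₗ.[ℂ] E} (hB : IsSelfAdjoint B)
    (hred : ∀ x y, (x, y) ∈ B.graph → ∃ u v, (V u, V v) ∈ B.graph ∧
      (∀ z, inner ℂ (x - V u) (V z) = 0) ∧ ∀ z, inner ℂ (y - V v) (V z) = 0) :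
    IsSelfAdjoint (restrictAlong V B) := by
  refine isSelfAdjoint_of_mem_graph_iff ?_ fun x y => ⟨fun h a b hab => ?_, fun h => ?_⟩
  · rw [Submodule.dense_iff_topologicalClosure_eq_top, Submodule.topologicalClosure_eq_top_iff,
      Submodule.eq_bot_iff]
    intro f hf
    rw [Submodule.mem_orthogonal] at hf
    rw [← map_eq_zero_iff V V.injective]
    refine hB.dense_domain.eq_zero_of_inner_right ℂ fun x hx => ?_
    obtain ⟨u, v, huv, hu, -⟩ := hred x _ (B.mem_graph ⟨x, hx⟩)
    have h₁ := hu f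
    rw [← mem_graph_restrictAlong] at huv
    rwa [inner_sub_left, V.inner_map_map, hf u (LinearPMap.mem_domain_of_mem_graph huv),
      sub_zero] at h₁
  · rw [mem_graph_restrictAlong] at h hab
    have := (mem_graph_iff_of_isSelfAdjoint hB _ _).1 h _ _ hab
    rwa [V.inner_map_map, V.inner_map_map] at this
  · rw [mem_graph_restrictAlong, mem_graph_iff_of_isSelfAdjoint hB]
    intro a b hab
    obtain ⟨u, v, huv, hu, hv⟩ := hred a b hab
    have h₁ := hu y
    have h₂ := hv x
    rw [inner_sub_left, V.inner_map_map, sub_eq_zero] at h₁ h₂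
    rw [h₁, h₂]
    exact h u v ((mem_graph_restrictAlong V B u v).2 huv)

/-- Cauchy–Schwarz for a nonnegative form: $t\mapsto\langle x+ta,T(x+ta)\rangle\ge0$ has no constant
term, so its linear coefficient vanishes for every `a` in the dense domain. -/
theorem eq_zero_of_re_inner_eq_zero [CompleteSpace E] {T : E →ₗ.[ℂ] E} (hT : IsSelfAdjoint T)
    (hpos : ∀ x y, (x, y) ∈ T.graph → 0 ≤ (inner ℂ x y).re) {x y : E} (hxy : (x, y) ∈ T.graph)
    (h : (inner ℂ x y).re = 0) : y = 0 := by
  have key : ∀ a b, (a, b) ∈ T.graph → (inner ℂ a y).re = 0 := by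
    intro a b hab
    have hsymm : (inner ℂ x b).re = (inner ℂ a y).re := by
      rw [← inner_conj_symm, Complex.conj_re,
        (mem_graph_iff_of_isSelfAdjoint hT _ _).1 hxy _ _ hab]
    have hquad : ∀ t : ℝ, 0 ≤ (inner ℂ a b).re * (t * t) + 2 * (inner ℂ a y).re * t + 0 := by
      intro t
      have := hpos _ _ (T.graph.add_mem hxy (T.graph.smul_mem (t : ℂ) hab))
      simp only [Prod.smul_mk, inner_add_left, inner_add_right, inner_smul_left, inner_smul_right,
        Complex.conj_ofReal, Complex.add_re, Complex.re_ofReal_mul, h, hsymm] at this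
      linarith
    have := discrim_le_zero hquad
    rw [discrim] at this
    nlinarith [sq_nonneg (inner ℂ a y).re]
  refine hT.dense_domain.eq_zero_of_inner_right ℂ fun a ha => ?_
  have hab := T.mem_graph ⟨a, ha⟩
  refine Complex.ext (key _ _ hab) ?_
  have := key _ _ (T.graph.smul_mem Complex.I hab)
  rw [inner_smul_left] at this
  simpa using this

theorem isNonneg_of_mem_graph [CompleteSpace E] {T : E →ₗ.[ℂ] E} (hT : IsSelfAdjoint T)
    (hpos : ∀ x y, (x, y) ∈ T.graph → 0 ≤ (inner ℂ x y).re) : IsNonneg T :=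
  ⟨hT, fun x => hpos _ _ (T.mem_graph x)⟩

theorem IsNonneg.isPos [CompleteSpace E] {T : E →ₗ.[ℂ] E} (hT : IsNonneg T)
    (hker : ker T = ⊥) : IsPos T := by
  have hpos : ∀ x y, (x, y) ∈ T.graph → 0 ≤ (inner ℂ x y).re := by
    intro x y h
    obtain ⟨u, rfl, rfl⟩ := (LinearPMap.mem_graph_iff T).1 h
    exact hT.2 u
  refine ⟨hT.1, fun x hx => (hT.2 x).lt_of_ne' fun h => hx ?_⟩
  have h₁ := eq_zero_of_re_inner_eq_zero hT.1 hpos (T.mem_graph x) h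
  have h₂ : (x : E) ∈ ker T := by
    rw [mem_ker_iff, ← h₁]
    exact T.mem_graph x
  rwa [hker, Submodule.mem_bot] at h₂

end Compression

/-! ### Assembling the unitary from $E=L\oplus jL$ -/

section Halves

variable {E : Type*} [NormedAddCommGroup E] [InnerProductSpace ℂ E] [CompleteSpace E]
  {H : Type*} [NormedAddCommGroup H] [InnerProductSpace ℂ H] [CompleteSpace H]
  {L : Submodule ℂ E}

/-- For $x\perp L$, write $jx=u+v$ along `L` and `Lᗮ`. Both $jx$ and $u$ are orthogonal to $jL$,
hence so is $v$; then $v=0$ and $x=ju$. -/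
theorem map_eq_orthogonal (j : E ≃ₗᵢ⋆[ℂ] E) (hj : ∀ x, j (j x) = x)
    (hin : ∀ x y, inner ℂ (j x) (j y) = inner ℂ y x) (hL : IsClosed (L : Set E))
    (hortho : ∀ x ∈ L, ∀ y ∈ L, inner ℂ x (j y) = 0)
    (htot : ∀ x, (∀ y ∈ L, inner ℂ y x = 0) → (∀ y ∈ L, inner ℂ (j y) x = 0) → x = 0) :
    L.map j.toLinearEquiv.toLinearMap = Lᗮ := by
  have : CompleteSpace L := hL.completeSpace_coe
  apply le_antisymm
  · rintro _ ⟨y, hy, rfl⟩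
    exact (Submodule.mem_orthogonal _ _).2 fun x hx => hortho x hx y hy
  · intro x hx
    obtain ⟨u, hu, v, hv, huv⟩ := L.exists_add_mem_mem_orthogonal (j x)
    have hv0 : v = 0 := by
      refine htot v ((Submodule.mem_orthogonal _ _).1 hv) fun y hy => ?_
      rw [← add_sub_cancel_left u v, ← huv, inner_sub_right, hin,
        (Submodule.mem_orthogonal' _ _).1 hx y hy, ← inner_conj_symm, hortho u hu y hy, map_zero,
        sub_zero]
    rw [hv0, add_zero] at huv
    exact ⟨u, hu, by rw [← huv]; exact hj x⟩

/-- If `E = L ⊕ j L` has twice the dimension of `H`, then `H` and `L` are isometric. -/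
theorem nonempty_linearIsometryEquiv_half [TopologicalSpace.SeparableSpace H]
    [TopologicalSpace.SeparableSpace E] (j : E ≃ₗᵢ⋆[ℂ] E)
    (hfin : FiniteDimensional ℂ H ↔ FiniteDimensional ℂ E)
    (hrank : FiniteDimensional ℂ H → Module.finrank ℂ E = 2 * Module.finrank ℂ H)
    (hL : IsClosed (L : Set E)) (hmap : L.map j.toLinearEquiv.toLinearMap = Lᗮ) :
    Nonempty (H ≃ₗᵢ[ℂ] L) := by
  have : CompleteSpace L := hL.completeSpace_coe
  have : TopologicalSpace.SeparableSpace L :=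
    (TopologicalSpace.IsSeparable.of_separableSpace (L : Set E)).separableSpace
  refine nonempty_linearIsometryEquiv H L ⟨fun h => ?_, fun h => hfin.2 ?_⟩ fun h => ?_
  · have := hfin.1 h
    infer_instance
  · have hfg : L.FG := Module.Finite.iff_fg.1 h
    have hfg' : Lᗮ.FG := hmap ▸ hfg.map _
    have htop : (⊤ : Submodule ℂ E).FG := by
      rw [← Submodule.sup_orthogonal_of_hasOrthogonalProjection (K := L)]
      exact hfg.sup hfg'
    exact ⟨htop⟩
  · have := hfin.1 h
    have h₁ := L.finrank_add_finrank_orthogonal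
    rw [← hmap, ← finrank_eq_of_antilinearEquiv (j.toLinearEquiv.submoduleMap L), hrank h] at h₁
    omega

/-- An isometry `V` from `H` onto `L`, where `E = L ⊕ j L`, extends to the unitary
`f ⊕ φ ↦ V f + j V J* φ` from `H ⊕ H*` to `E`. -/
theorem exists_unitary_extension (j : E ≃ₗᵢ⋆[ℂ] E) (V : H →ₗᵢ[ℂ] E)
    (hortho : ∀ x y, inner ℂ (V x) (j (V y)) = 0)
    (htot : ∀ x, (∀ y, inner ℂ (V y) x = 0) → (∀ y, inner ℂ (j (V y)) x = 0) → x = 0) :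
    ∃ W : Doubled H ≃ₗᵢ[ℂ] E, ∀ x, W x = V x.fst + j (V ((J H).symm x.snd)) := by
  let W : Doubled H →ₗᵢ[ℂ] E :=
    { toFun := fun x => V x.fst + j (V ((J H).symm x.snd))
      map_add' := fun x y => by
        simp only [WithLp.add_fst, WithLp.add_snd, map_add]
        abel
      map_smul' := fun c x => by
        simp only [WithLp.smul_fst, WithLp.smul_snd, map_smul, LinearIsometryEquiv.map_smulₛₗ,
          Complex.conj_conj, RingHom.id_apply, smul_add]
      norm_map' := fun x => by
        refine (sq_eq_sq₀ (norm_nonneg _) (norm_nonneg _)).1 ?_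
        change ‖V x.fst + j (V ((J H).symm x.snd))‖ ^ 2 = _
        rw [@norm_add_sq ℂ, hortho, WithLp.prod_norm_sq_eq_of_L2]
        simp }
  have hW : ∀ x, W x = V x.fst + j (V ((J H).symm x.snd)) := fun _ => rfl
  have hsurj : Function.Surjective W := by
    have hclosed : IsClosed (LinearMap.range W.toLinearMap : Set E) := by
      rw [LinearMap.coe_range]
      exact W.isometry.isClosedEmbedding.isClosed_range
    have : CompleteSpace (LinearMap.range W.toLinearMap) := hclosed.completeSpace_coe
    rw [← LinearIsometry.coe_toLinearMap, ← LinearMap.range_eq_top,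
      ← Submodule.orthogonal_eq_bot_iff, Submodule.eq_bot_iff]
    intro x hx
    rw [Submodule.mem_orthogonal] at hx
    refine htot x (fun y => hx _ ⟨WithLp.toLp 2 (y, 0), ?_⟩)
      (fun y => hx _ ⟨WithLp.toLp 2 (0, J H y), ?_⟩)
    · change W _ = _
      simp [hW]
    · change W _ = _
      simp [hW]
  exact ⟨LinearIsometryEquiv.ofSurjective W hsurj, hW⟩

/-- Block diagonalization of a self-adjoint operator `B` anticommuting with an anti-unitary
involution `j`, on a space of twice the dimension of `H`. -/
theorem exists_blockDiag_of_anticommute [TopologicalSpace.SeparableSpace H]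
    [TopologicalSpace.SeparableSpace E] (j : E ≃ₗᵢ⋆[ℂ] E) (hj : ∀ x, j (j x) = x)
    (hin : ∀ x y, inner ℂ (j x) (j y) = inner ℂ y x)
    (hfin : FiniteDimensional ℂ H ↔ FiniteDimensional ℂ E)
    (hrank : FiniteDimensional ℂ H → Module.finrank ℂ E = 2 * Module.finrank ℂ H)
    {B : E →ₗ.[ℂ] E} (hB : IsSelfAdjoint B)
    (hjB : ∀ x y, (x, y) ∈ B.graph → (j x, -j y) ∈ B.graph)
    (hker : ¬ FiniteDimensional ℂ (ker B) ∨ Even (Module.finrank ℂ (ker B))) :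
    ∃ (W : Doubled H ≃ₗᵢ[ℂ] E) (ξ : H →ₗ.[ℂ] H),
      (∀ x, j (W (calJ H x)) = W x) ∧ IsNonneg ξ ∧
      (∀ x y, (W x, W y) ∈ B.graph ↔
        (x, y) ∈ (blockDiag ξ (-conjugate (J H) ξ)).graph) ∧
      (ker B = ⊥ → ker ξ = ⊥) := by
  obtain ⟨L, hL, hortho, htot, hred, hpos⟩ := exists_reducing_nonneg_half j hj hin hB hjB hker
  obtain ⟨e⟩ := nonempty_linearIsometryEquiv_half j hfin hrank hL
    (map_eq_orthogonal j hj hin hL hortho htot)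
  let V : H →ₗᵢ[ℂ] E := L.subtypeₗᵢ.comp e.toLinearIsometry
  have hVL : ∀ x, V x ∈ L := fun x => (e x).2
  have hLV : ∀ x ∈ L, ∃ y, V y = x := fun x hx =>
    ⟨e.symm ⟨x, hx⟩, congrArg Subtype.val (e.apply_symm_apply ⟨x, hx⟩)⟩
  have hVJ : ∀ x, j (V x) ∈ Lᗮ := fun x =>
    (Submodule.mem_orthogonal _ _).2 fun y hy => hortho y hy _ (hVL x)
  have hdisj : ∀ x ∈ L, x ∈ Lᗮ → x = 0 := fun x hx hx' =>
    inner_self_eq_zero.1 ((Submodule.mem_orthogonal _ _).1 hx' x hx)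
  obtain ⟨W, hW⟩ := exists_unitary_extension j V (fun x y => hortho _ (hVL x) _ (hVL y))
    (fun x h₁ h₂ => htot x
      (fun y hy => by obtain ⟨z, rfl⟩ := hLV y hy; exact h₁ z)
      (fun y hy => by obtain ⟨z, rfl⟩ := hLV y hy; exact h₂ z))
  have hsa : IsSelfAdjoint (restrictAlong V B) := by
    refine isSelfAdjoint_restrictAlong V hB fun x y hxy => ?_
    obtain ⟨u, hu, v, hv, huv, hxu, hyv⟩ := hred x y hxy
    obtain ⟨u, rfl⟩ := hLV u hu
    obtain ⟨v, rfl⟩ := hLV v hv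
    exact ⟨u, v, huv, fun z => (Submodule.mem_orthogonal' _ _).1 hxu _ (hVL z),
      fun z => (Submodule.mem_orthogonal' _ _).1 hyv _ (hVL z)⟩
  refine ⟨W, restrictAlong V B, fun x => ?_, ?_, fun x y => ?_, fun hk => ?_⟩
  · rw [hW, hW, map_add, hj, calJ_apply, add_comm]
    simp only [WithLp.toLp_fst, WithLp.toLp_snd, LinearIsometryEquiv.symm_apply_apply]
  · refine isNonneg_of_mem_graph hsa fun x y hxy => ?_
    rw [mem_graph_restrictAlong] at hxy
    rw [← V.inner_map_map]
    exact hpos _ _ hxy (hVL x)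
  · rw [mem_graph_blockDiag, mem_graph_neg, mem_graph_conjugate, mem_graph_restrictAlong,
      mem_graph_restrictAlong, hW, hW, map_neg, map_neg]
    constructor
    · intro h
      obtain ⟨u, hu, v, hv, huv, hxu, hyv⟩ := hred _ _ h
      -- Components along `L` are unique, so the pair of first components lies in the graph. The
      -- remaining pair lives on $jL$; applying $j$ carries it back to `L` and flips the sign, which
      -- produces $-J\xi J^*$.
      have h₁ : V x.fst = u := sub_eq_zero.1 <| hdisj _ (L.sub_mem (hVL _) hu) <| by
        simpa [add_sub_right_comm] using Lᗮ.sub_mem hxu (hVJ ((J H).symm x.snd))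
      have h₂ : V y.fst = v := sub_eq_zero.1 <| hdisj _ (L.sub_mem (hVL _) hv) <| by
        simpa [add_sub_right_comm] using Lᗮ.sub_mem hyv (hVJ ((J H).symm y.snd))
      rw [← h₁, ← h₂] at huv
      refine ⟨huv, ?_⟩
      have h₃ := B.graph.sub_mem h huv
      rw [Prod.mk_sub_mk, add_sub_cancel_left, add_sub_cancel_left] at h₃
      simpa [hj] using hjB _ _ h₃
    · rintro ⟨h₁, h₂⟩
      have h₃ := B.graph.add_mem h₁ (hjB _ _ h₂)
      simpa using h₃
  · rw [Submodule.eq_bot_iff]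
    intro x hx
    rw [mem_ker_iff, mem_graph_restrictAlong, map_zero, ← mem_ker_iff, hk,
      Submodule.mem_bot] at hx
    exact (map_eq_zero_iff V V.injective).1 hx

end Halves

/-! ### The space $\mathfrak h\oplus\mathfrak h^*$ and its dimension -/

section Doubling

variable (H : Type*) [NormedAddCommGroup H] [InnerProductSpace ℂ H] [CompleteSpace H]

theorem calJ_calJ (x : Doubled H) : calJ H (calJ H x) = x := (calJ H).symm_apply_apply x

theorem inner_calJ_calJ (x y : Doubled H) : inner ℂ (calJ H x) (calJ H y) = inner ℂ y x := by
  have h : ∀ a b : StrongDual ℂ H,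
      inner ℂ a b = inner ℂ ((J H).symm b) ((J H).symm a) := fun _ _ => rfl
  rw [WithLp.prod_inner_apply, WithLp.prod_inner_apply, calJ_apply, calJ_apply]
  simp only [h, LinearIsometryEquiv.symm_apply_apply]
  exact add_comm _ _

theorem separableSpace_doubled [TopologicalSpace.SeparableSpace H] :
    TopologicalSpace.SeparableSpace (Doubled H) := by
  have : TopologicalSpace.SeparableSpace (StrongDual ℂ H) :=
    (J H).surjective.denseRange.separableSpace (J H).continuous
  exact (WithLp.toLp_surjective 2).denseRange.separableSpace (WithLp.prod_continuous_toLp 2 _ _)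

theorem finiteDimensional_strongDual [FiniteDimensional ℂ H] :
    FiniteDimensional ℂ (StrongDual ℂ H) :=
  Module.Finite.of_injective (J H).symm.toLinearEquiv.toLinearMap (J H).symm.injective

theorem finiteDimensional_doubled_iff :
    FiniteDimensional ℂ H ↔ FiniteDimensional ℂ (Doubled H) := by
  constructor
  · intro h
    have := finiteDimensional_strongDual H
    exact Module.Finite.equiv (WithLp.linearEquiv 2 ℂ (H × StrongDual ℂ H)).symm
  · intro h
    have : FiniteDimensional ℂ (H × StrongDual ℂ H) :=
      Module.Finite.equiv (WithLp.linearEquiv 2 ℂ (H × StrongDual ℂ H))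
    exact Module.Finite.of_injective (LinearMap.inl ℂ H (StrongDual ℂ H)) LinearMap.inl_injective

theorem finrank_doubled [FiniteDimensional ℂ H] :
    Module.finrank ℂ (Doubled H) = 2 * Module.finrank ℂ H := by
  have := finiteDimensional_strongDual H
  rw [(WithLp.linearEquiv 2 ℂ (H × StrongDual ℂ H)).finrank_eq, Module.finrank_prod,
    ← finrank_eq_of_antilinearEquiv (J H).toLinearEquiv, two_mul]

end Doubling

end Fermionic

/-! ### The diagonalization theorem -/

open Fermionic in
theorem theorem3 {H : Type*} [NormedAddCommGroup H] [InnerProductSpace ℂ H] [CompleteSpace H]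
    [TopologicalSpace.SeparableSpace H]
    (B : Fermionic.Doubled H →ₗ.[ℂ] Fermionic.Doubled H)
    (hB : IsSelfAdjoint B)
    (hJB : Fermionic.conjugate (Fermionic.calJ H) B = -B)
    (hker : ¬ FiniteDimensional ℂ (Fermionic.ker B) ∨
      Even (Module.finrank ℂ (Fermionic.ker B))) :
    ∃ (U : Fermionic.Doubled H ≃ₗᵢ[ℂ] Fermionic.Doubled H) (ξ : H →ₗ.[ℂ] H),
      (∀ x, Fermionic.calJ H (U (Fermionic.calJ H x)) = U x) ∧
      Fermionic.IsNonneg ξ ∧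
      Fermionic.conjugate U B =
        Fermionic.blockDiag ξ (-Fermionic.conjugate (Fermionic.J H) ξ) ∧
      (Fermionic.ker B = ⊥ → Fermionic.IsPos ξ) := by
  have hjB : ∀ x y, (x, y) ∈ B.graph → (calJ H x, -calJ H y) ∈ B.graph := by
    intro x y h
    rw [← mem_graph_neg, ← hJB, mem_graph_conjugate, calJ_symm, calJ_calJ, calJ_calJ]
    exact h
  have := separableSpace_doubled H
  obtain ⟨W, ξ, hWJ, hξ, hW, hk⟩ := exists_blockDiag_of_anticommute (calJ H) (calJ_calJ H)
    (inner_calJ_calJ H) (finiteDimensional_doubled_iff H) (fun _ => finrank_doubled H) hB hjB hker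
  refine ⟨W.symm, ξ, fun x => ?_, hξ, ?_, fun h => hξ.isPos (hk h)⟩
  · apply W.injective
    rw [← hWJ, calJ_calJ, W.apply_symm_apply, calJ_calJ, W.apply_symm_apply]
  · refine graph_ext fun x y => ?_
    rw [mem_graph_conjugate, LinearIsometryEquiv.symm_symm]
    exact hW x y
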